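/- **Setting.** A non-stationary Lipschitz bandit environment with arm space $[0,1]$ is fixed in advance (oblivious adversary). It consists, for every round $t$, of a family of reward distributions on $[0,1]$, one for each arm $x\in[0,1]$ (depending measurably on $x$), whose mean $\mu_t(x)$ satisfies $|\mu_t(x)-\mu_t(x')|\le|x-x'|$ for all $x,x'\in[0,1]$. A (possibly randomized) algorithm $\pi$ selects in round $t$ an arm $x_t\in[0,1]$ on the basis of the arms and rewards of the rounds $1,\dots,t-1$ and of internal randomization, and then observes a reward drawn, independently of the past given $x_t$, from the distribution of arm $x_t$ in round $t$. Write $\delta_t(x)=\sup_{x'\in[0,1]}\mu_t(x')-\mu_t(x)$. The dynamic regret over the horizon $T$ is $R(\pi,T)=\sum_{t=1}^T\delta_t(x_t)$, and $\mathbb E_{\boldsymbol\mu}$ denotes the expectation over the interaction of $\pi$ with the environment $\boldsymbol\mu$. An arm $x$ incurs significant regret on an interval of rounds $[s_1,s_2]$ with $s_1<s_2$ if $\sum_{t=s_1}^{s_2}\delta_t(x)\ge\log(T)\,(s_2-s_1)^{2/3}$. Let $\tau_0=1$; for $i\ge1$ the $i$-th significant shift $\tau_i$ is the smallest round in $(\tau_{i-1},T]$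 such that for every arm $x\in[0,1]$ there is an interval $[s_1,s_2]\subseteq[\tau_{i-1},\tau_i]$ on which $x$ incurs significant regret, if there is such a round. Let $\tilde L_T$ be the number of significant shifts $\tau_i$ with $i\ge1$, and let $V_T=\sum_{t=1}^{T-1}\sup_{x\in[0,1]}|\mu_{t+1}(x)-\mu_t(x)|$ be the total variation. **Theorem.** There is a numerical constant $c_1>0$ such that for every integer $T\ge1$, every integer $\tilde L$ with $0\le\tilde L\le T$ and every algorithm $\pi$, there is a non-stationary Lipschitz bandit environment $\boldsymbol\mu$ with $\tilde L_T\le\tilde L$ and $$\mathbb E_{\boldsymbol\mu}[R(\pi,T)]\ \ge\ c_1\,\tilde L^{1/3}\,T^{2/3}.$$ Likewise, there is a numerical constant $c_2>0$ such that for every integer $T\ge1$, every real $V$ with $0\le V\le T$ and every algorithm $\pi$, there is a non-stationary Lipschitz bandit environment $\boldsymbol\mu$ with $V_T\le V$ and $$\mathbb E_{\boldsymbol\mu}[R(\pi,T)]\ \ge\ c_2\left(T^{2/3}+V^{1/4}T^{3/4}\right).$$ -/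

import Mathlib

open MeasureTheory ProbabilityTheory

namespace LipBandit

/-- The arm space `[0,1]`; rewards take values in the same interval. -/
abbrev Arm : Type := Set.Icc (0 : ℝ) 1

/-- A non-stationary bandit environment (oblivious adversary): for every round `t = 1, 2, …` a
measurable family of reward distributions on `[0,1]`, one for each arm, whose mean is a
`1`-Lipschitz function of the arm. The entry of index `0` is never used. -/
structure Environment where
  /-- `reward t x` is the distribution of the reward observed when arm `x` is played in round `t` -/
  reward : ℕ → Kernel Arm (Set.Icc (0 : ℝ) 1)
  isMarkov : ∀ t, IsMarkovKernel (reward t)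
  lipschitz : ∀ (t : ℕ) (x x' : Arm),
    |(∫ y, (y : ℝ) ∂(reward t x)) - ∫ y, (y : ℝ) ∂(reward t x')| ≤ |(x : ℝ) - x'|

/-- The mean reward function `μ_t`. -/
noncomputable def Environment.mean (e : Environment) (t : ℕ) (x : Arm) : ℝ :=
  ∫ y, (y : ℝ) ∂(e.reward t x)

/-- The instantaneous regret `δ_t(x) = sup_{x'} μ_t(x') - μ_t(x)`. -/
noncomputable def Environment.gap (e : Environment) (t : ℕ) (x : Arm) : ℝ :=
  (⨆ x' : Arm, e.mean t x') - e.mean t x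

/-- Histories of `n` rounds: the entry `i` is the pair (arm, observed reward) of round `i + 1`. -/
abbrev History (n : ℕ) : Type := Fin n → Arm × Set.Icc (0 : ℝ) 1

/-- A (randomized) bandit algorithm: given the history of the first `n` rounds, it draws the arm of
round `n + 1` from the distribution `select n`. -/
structure Algorithm where
  select : (n : ℕ) → Kernel (History n) Arm
  isMarkov : ∀ n, IsMarkovKernel (select n)

/-- The conditional law of the pair (arm, reward) of round `n + 1` given the history: the arm is
drawn by the algorithm, the reward from the reward distribution of that arm in round `n + 1`. -/
noncomputable def stepKernel (e : Environment) (π : Algorithm) (n : ℕ) :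
    Kernel (History n) (Arm × Set.Icc (0 : ℝ) 1) :=
  (π.select n) ⊗ₖ (Kernel.prodMkLeft (History n) (e.reward (n + 1)))

/-- Appending one round to a history. -/
def History.append {n : ℕ} (p : History n × (Arm × Set.Icc (0 : ℝ) 1)) : History (n + 1) :=
  Fin.snoc (α := fun _ => Arm × Set.Icc (0 : ℝ) 1) p.1 p.2

/-- The law of the history of the first `n` rounds of the interaction of `π` with `e`. -/
noncomputable def historyLaw (e : Environment) (π : Algorithm) : (n : ℕ) → Measure (History n)
  | 0 => Measure.dirac Fin.elim0
  | n + 1 => ((historyLaw e π n) ⊗ₘ (stepKernel e π n)).map History.append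

/-- The expected dynamic regret `𝔼[∑_{t=1}^T (sup_x μ_t(x) - μ_t(x_t))]`. -/
noncomputable def expectedRegret (e : Environment) (π : Algorithm) (T : ℕ) : ℝ :=
  ∫ h, ∑ i : Fin T, e.gap ((i : ℕ) + 1) (h i).1 ∂(historyLaw e π T)

/-- Arm `x` incurs significant regret on the interval `[s₁, s₂]`, for the horizon `T`. The interval
has to be nondegenerate, since for `s₁ = s₂` the inequality would hold for every arm. -/
def SignificantRegret (e : Environment) (T : ℕ) (x : Arm) (s₁ s₂ : ℕ) : Prop :=
  s₁ < s₂ ∧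
    Real.log T * ((s₂ : ℝ) - s₁) ^ (2 / 3 : ℝ) ≤ ∑ t ∈ Finset.Icc s₁ s₂, e.gap t x

/-- Every arm incurs significant regret on some interval contained in `[a, b]`. -/
def AllUnsafe (e : Environment) (T : ℕ) (a b : ℕ) : Prop :=
  ∀ x : Arm, ∃ s₁ s₂ : ℕ, a ≤ s₁ ∧ s₂ ≤ b ∧ SignificantRegret e T x s₁ s₂

/-- The significant shifts: `τ_0 = 1`, and `τ_i` is the smallest round in `(τ_{i-1}, T]` such that
all arms incur significant regret within `[τ_{i-1}, τ_i]`. The value `⊤` means that there is no such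
round, that is, that the `i`-th significant shift does not exist. -/
noncomputable def significantShift (e : Environment) (T : ℕ) : ℕ → ℕ∞
  | 0 => 1
  | i + 1 => sInf {b : ℕ∞ | ∃ n a : ℕ, b = n ∧ significantShift e T i = a ∧ a < n ∧ n ≤ T ∧
      AllUnsafe e T a n}

/-- The number of significant shifts in `T` rounds (`τ_0 = 1` is not a shift). -/
noncomputable def numSignificantShifts (e : Environment) (T : ℕ) : ℕ∞ :=
  Set.encard {i : ℕ | 1 ≤ i ∧ significantShift e T i ≠ ⊤}

/-- The total variation `∑_{t=1}^{T-1} sup_x |μ_{t+1}(x) - μ_t(x)|`. -/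
noncomputable def totalVariation (e : Environment) (T : ℕ) : ℝ :=
  ∑ t ∈ Finset.Ico 1 T, ⨆ x : Arm, |e.mean (t + 1) x - e.mean t x|

/-- The environments with at most `L` significant shifts in `T` rounds. -/
def shiftClass (T L : ℕ) : Set Environment := {e | numSignificantShifts e T ≤ L}

/-- The environments with total variation at most `V` in `T` rounds. -/
def variationClass (T : ℕ) (V : ℝ) : Set Environment := {e | totalVariation e T ≤ V}

end LipBandit

/-!
The hard environments have Bernoulli rewards. The horizon is cut into blocks of `n` rounds; within a
block the mean reward is `1/2` plus a tent of height and half-width `ε = 1/(2K)`, placed over one of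
`K` disjoint cells of `[0,1]`, with `K` of order `n ^ (1/3)`. An arm outside the cell has gap `ε`.

Let `P` be the law of the history when one block is made flat and `P'` the law when that block has
the tent `k` instead, all other blocks being equal. The density of `P'` with respect to `P` is
`∏ (1 + z i)`, where `z i` is the increment `2 w (2 y - 1)` of round `i`
(`lintegral_historyLaw_eq_density`). Since `log (1 + z) ≥ z - 2 z ^ 2` and `u ≥ 1 + log u`, it is at
least `1 + S - 2 Q ≥ 7/8 - 2 S ^ 2 - 2 Q` with `S = ∑ z i` and `Q = ∑ z i ^ 2`. Under `P` the sum
`S` is a martingale, so `S ^ 2` and `Q` have the same mean (`lintegral_sum_increment_sq`), and that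
mean is at most `4 ε ^ 2` times the expected number of plays in the cell `k`. As the `K` cells share
at most `n` plays under `P`, which does not depend on `k`, on average over `k` the cell is missed in
a constant fraction of the rounds of the block (`le_integral_misses`, `le_sum_integral_misses`).
This is a regret of order `ε n`, that is `n ^ (2/3)`, per block. The bound holds whatever the other
blocks are, so averaging over all vectors of cells gives one environment whose regret is at least
the sum of the block bounds (`exists_card_mul_le_sum`).

Within a block the best arm has gap `0`, so every significant shift needs a change of block
(`numSignificantShifts_le_card`), and a change of block costs a variation of at most `ε`
(`totalVariation_le_card_mul`). With `L` blocks of `⌊T / L⌋` rounds the first bound follows. For the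
second, the blocks have about `(T / V) ^ (3/4)` rounds, or a single block is used if
`V ≤ T ^ (-1/3)`.
-/

namespace LipBandit

open scoped ENNReal

/-! ### Environments with two-point rewards -/

/-- A `1`-Lipschitz function on the arms with values in `[-1/2, 1/2]`: the deviation of the mean
reward from `1/2`. -/
structure Bias where
  val : Arm → ℝ
  abs_le : ∀ x, |val x| ≤ 1 / 2
  lipschitz : ∀ x x', |val x - val x'| ≤ |(x : ℝ) - x'|

lemma Bias.continuous (b : Bias) : Continuous b.val :=
  (LipschitzWith.of_dist_le_mul (K := 1) fun x y => by
    simpa [Subtype.dist_eq, Real.dist_eq] using b.lipschitz x y).continuous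

lemma Bias.measurable (b : Bias) : Measurable b.val := b.continuous.measurable

lemma Bias.half_add_nonneg (b : Bias) (x : Arm) : 0 ≤ 1 / 2 + b.val x := by
  have := _root_.abs_le.mp (b.abs_le x); linarith

lemma Bias.half_sub_nonneg (b : Bias) (x : Arm) : 0 ≤ 1 / 2 - b.val x := by
  have := _root_.abs_le.mp (b.abs_le x); linarith

/-- The Bernoulli rewards with mean `1/2 + b x` at the arm `x`. -/
noncomputable def Bias.law (b : Bias) : Kernel Arm (Set.Icc (0 : ℝ) 1) where
  toFun x := ENNReal.ofReal (1 / 2 + b.val x) • Measure.dirac 1 +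
    ENNReal.ofReal (1 / 2 - b.val x) • Measure.dirac 0
  measurable' := by
    have := b.measurable
    refine Measure.measurable_of_measurable_coe _ fun s _ => ?_
    simp only [Measure.coe_add, Measure.coe_smul, Pi.add_apply, Pi.smul_apply, smul_eq_mul]
    fun_prop

lemma Bias.law_apply (b : Bias) (x : Arm) :
    b.law x = ENNReal.ofReal (1 / 2 + b.val x) • Measure.dirac 1 +
      ENNReal.ofReal (1 / 2 - b.val x) • Measure.dirac 0 := rfl

instance (b : Bias) : IsMarkovKernel b.law := ⟨fun x => ⟨by
  simp only [Bias.law_apply, Measure.coe_add, Measure.coe_smul, Pi.add_apply, Pi.smul_apply,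
    measure_univ, smul_eq_mul, mul_one]
  rw [← ENNReal.ofReal_add (b.half_add_nonneg x) (b.half_sub_nonneg x)]
  norm_num⟩⟩

lemma Bias.lintegral_law (b : Bias) (x : Arm) (f : Set.Icc (0 : ℝ) 1 → ℝ≥0∞) :
    ∫⁻ y, f y ∂(b.law x) =
      ENNReal.ofReal (1 / 2 + b.val x) * f 1 + ENNReal.ofReal (1 / 2 - b.val x) * f 0 := by
  simp [Bias.law_apply, lintegral_add_measure, lintegral_smul_measure]

lemma Bias.integral_law (b : Bias) (x : Arm) : ∫ y, (y : ℝ) ∂(b.law x) = 1 / 2 + b.val x := by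
  have h := b.half_add_nonneg x
  rw [integral_eq_lintegral_of_nonneg_ae (ae_of_all _ fun y => y.2.1)
    measurable_subtype_coe.aestronglyMeasurable, b.lintegral_law]
  simp only [Set.Icc.coe_one, Set.Icc.coe_zero, ENNReal.ofReal_one, ENNReal.ofReal_zero, mul_one,
    mul_zero, add_zero]
  exact ENNReal.toReal_ofReal h

/-- The environment with Bernoulli rewards of mean `1/2 + b t` in round `t`. -/
noncomputable def biasedEnv (b : ℕ → Bias) : Environment where
  reward t := (b t).law
  isMarkov _ := inferInstance
  lipschitz t x x' := by
    simpa [Bias.integral_law] using (b t).lipschitz x x'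

lemma biasedEnv_mean (b : ℕ → Bias) (t : ℕ) (x : Arm) :
    (biasedEnv b).mean t x = 1 / 2 + (b t).val x := (b t).integral_law x

instance (e : Environment) (t : ℕ) : IsMarkovKernel (e.reward t) := e.isMarkov t

instance (π : Algorithm) (n : ℕ) : IsMarkovKernel (π.select n) := π.isMarkov n

instance (e : Environment) (π : Algorithm) (n : ℕ) : IsMarkovKernel (stepKernel e π n) := by
  unfold stepKernel; infer_instance

lemma measurable_append {n : ℕ} : Measurable (History.append (n := n)) := by
  refine measurable_pi_iff.mpr fun i => ?_
  refine Fin.lastCases ?_ (fun i => ?_) i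
  · simpa [History.append] using measurable_snd
  · simp only [History.append, Fin.snoc_castSucc]
    exact (measurable_pi_apply i).comp measurable_fst

@[simp] lemma append_castSucc {n : ℕ} (p : History n × (Arm × Set.Icc (0 : ℝ) 1)) (i : Fin n) :
    History.append p i.castSucc = p.1 i := by simp [History.append]

@[simp] lemma append_last {n : ℕ} (p : History n × (Arm × Set.Icc (0 : ℝ) 1)) :
    History.append p (Fin.last n) = p.2 := by simp [History.append]

instance (e : Environment) (π : Algorithm) (n : ℕ) : IsProbabilityMeasure (historyLaw e π n) := by
  induction n with
  | zero => unfold historyLaw; infer_instance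
  | succ n ih => exact Measure.isProbabilityMeasure_map measurable_append.aemeasurable

/-- The law of one more round, with the average over the two possible rewards written out. -/
lemma lintegral_historyLaw_succ (b : ℕ → Bias) (π : Algorithm) (n : ℕ) {f : History (n + 1) → ℝ≥0∞}
    (hf : Measurable f) :
    ∫⁻ h, f h ∂(historyLaw (biasedEnv b) π (n + 1)) =
      ∫⁻ h, ∫⁻ x, (ENNReal.ofReal (1 / 2 + (b (n + 1)).val x) * f (History.append (h, x, 1)) +
          ENNReal.ofReal (1 / 2 - (b (n + 1)).val x) * f (History.append (h, x, 0)))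
        ∂(π.select n h) ∂(historyLaw (biasedEnv b) π n) := by
  have hfa : Measurable fun p => f (History.append (n := n) p) := hf.comp measurable_append
  rw [historyLaw, lintegral_map hf measurable_append, Measure.lintegral_compProd hfa]
  refine lintegral_congr fun h => ?_
  have hfh : Measurable fun p => f (History.append (h, p)) := hfa.comp measurable_prodMk_left
  rw [stepKernel, Kernel.lintegral_compProd _ _ _ hfh]
  refine lintegral_congr fun x => ?_
  exact (b (n + 1)).lintegral_law x _

/-! ### Change of measure -/

/-- The increment `2 w (2 y - 1)` of the likelihood ratio when the bias at the arm played moves from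
`0` to `w` and the reward is `y`. -/
def increment (w : ℕ → Bias) {n : ℕ} (h : History n) (i : Fin n) : ℝ :=
  2 * (w (i + 1)).val (h i).1 * (2 * ((h i).2 : ℝ) - 1)

lemma measurable_increment (w : ℕ → Bias) {n : ℕ} (i : Fin n) :
    Measurable fun h : History n => increment w h i := by
  unfold increment
  have := (w (i + 1)).measurable
  fun_prop

@[simp] lemma increment_castSucc (w : ℕ → Bias) {n : ℕ} (h : History n)
    (q : Arm × Set.Icc (0 : ℝ) 1) (i : Fin n) :
    increment w (History.append (h, q)) i.castSucc = increment w h i := by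
  simp [increment]

lemma one_add_increment_nonneg (w : ℕ → Bias) {n : ℕ} (h : History n) (i : Fin n) :
    0 ≤ 1 + increment w h i := by
  have h1 := (w (i + 1)).abs_le (h i).1
  have h2 : |2 * ((h i).2 : ℝ) - 1| ≤ 1 := by
    have := (h i).2.2
    rw [abs_le]; constructor <;> linarith [this.1, this.2]
  have : |increment w h i| ≤ 1 := by
    rw [increment, abs_mul, abs_mul, abs_two]
    nlinarith [abs_nonneg ((w (i + 1)).val (h i).1), abs_nonneg (2 * ((h i).2 : ℝ) - 1)]
  linarith [(abs_le.mp this).1]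

/-- If `b' = b + w` and `w` vanishes wherever `b` does not, then the law of the history under `b'`
has the density `∏ (1 + increment)` with respect to the one under `b`. -/
lemma lintegral_historyLaw_eq_density {b b' w : ℕ → Bias}
    (hw : ∀ t x, (b' t).val x = (b t).val x + (w t).val x)
    (hbw : ∀ t x, (b t).val x * (w t).val x = 0) (π : Algorithm) (n : ℕ)
    {f : History n → ℝ≥0∞} (hf : Measurable f) :
    ∫⁻ h, f h ∂(historyLaw (biasedEnv b') π n) =
      ∫⁻ h, ENNReal.ofReal (∏ i, (1 + increment w h i)) * f h
        ∂(historyLaw (biasedEnv b) π n) := by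
  induction n with
  | zero => simp [historyLaw]
  | succ n ih =>
    have hmeas (m : ℕ) :
        Measurable fun h : History m => ENNReal.ofReal (∏ i, (1 + increment w h i)) :=
      ENNReal.measurable_ofReal.comp (Finset.measurable_fun_prod _ fun i _ =>
        (measurable_increment w i).const_add 1)
    have hb1 := (b (n + 1)).measurable
    have hb1' := (b' (n + 1)).measurable
    rw [lintegral_historyLaw_succ b' π n hf, lintegral_historyLaw_succ b π n
      (f := fun h => ENNReal.ofReal (∏ i, (1 + increment w h i)) * f h) ((hmeas _).mul hf)]
    rw [ih]
    · refine lintegral_congr fun h => ?_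
      rw [← lintegral_const_mul]
      · refine lintegral_congr fun x => ?_
        have hL : 0 ≤ ∏ i, (1 + increment w h i) :=
          Finset.prod_nonneg fun i _ => one_add_increment_nonneg w h i
        have e1 : (1 / 2 + (b' (n + 1)).val x) =
            (1 / 2 + (b (n + 1)).val x) * (1 + 2 * (w (n + 1)).val x) := by
          rw [hw]; linear_combination -2 * hbw (n + 1) x
        have e0 : (1 / 2 - (b' (n + 1)).val x) =
            (1 / 2 - (b (n + 1)).val x) * (1 - 2 * (w (n + 1)).val x) := by
          rw [hw]; linear_combination -2 * hbw (n + 1) x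
        rw [e1, e0, ENNReal.ofReal_mul ((b _).half_add_nonneg x),
          ENNReal.ofReal_mul ((b _).half_sub_nonneg x)]
        simp only [Fin.prod_univ_castSucc, increment_castSucc]
        rw [ENNReal.ofReal_mul hL, ENNReal.ofReal_mul hL]
        have i1 : 1 + increment w (History.append (h, x, 1)) (Fin.last n) =
            1 + 2 * (w (n + 1)).val x := by
          simp [increment]; ring
        have i0 : 1 + increment w (History.append (h, x, 0)) (Fin.last n) =
            1 - 2 * (w (n + 1)).val x := by
          simp [increment]; ring
        rw [i1, i0]
        ring
      · have := measurable_append (n := n)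
        fun_prop
    · have := measurable_append (n := n)
      have hpm : Measurable fun p : History n × Arm =>
          (ENNReal.ofReal (1 / 2 + (b' (n + 1)).val p.2) * f (History.append (p.1, p.2, 1)) +
          ENNReal.ofReal (1 / 2 - (b' (n + 1)).val p.2) * f (History.append (p.1, p.2, 0))) := by
        fun_prop
      exact Measurable.lintegral_kernel_prod_right' (κ := π.select n) hpm

/-- The partial sums of the increments form a martingale with orthogonal increments. -/
lemma lintegral_sum_increment_sq {b w : ℕ → Bias}
    (hbw : ∀ t x, (b t).val x * (w t).val x = 0) (π : Algorithm) (n : ℕ) :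
    ∫⁻ h, ENNReal.ofReal ((∑ i, increment w h i) ^ 2) ∂(historyLaw (biasedEnv b) π n) =
      ∫⁻ h, ENNReal.ofReal (∑ i, increment w h i ^ 2) ∂(historyLaw (biasedEnv b) π n) := by
  have hS (m : ℕ) : Measurable fun h : History m => ∑ i, increment w h i :=
    Finset.measurable_fun_sum _ fun i _ => measurable_increment w i
  have hQ (m : ℕ) : Measurable fun h : History m => ∑ i, increment w h i ^ 2 :=
    Finset.measurable_fun_sum _ fun i _ => (measurable_increment w i).pow_const 2
  induction n with
  | zero => simp
  | succ n ih =>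
    rw [lintegral_historyLaw_succ b π n (by have := hS (n + 1); fun_prop),
      lintegral_historyLaw_succ b π n (by have := hQ (n + 1); fun_prop)]
    have hb (x : Arm) := (b (n + 1)).half_add_nonneg x
    have hb' (x : Arm) := (b (n + 1)).half_sub_nonneg x
    have i1 (h : History n) (x : Arm) :
        increment w (History.append (h, x, 1)) (Fin.last n) = 2 * (w (n + 1)).val x := by
      simp [increment]; ring
    have i0 (h : History n) (x : Arm) :
        increment w (History.append (h, x, 0)) (Fin.last n) = -2 * (w (n + 1)).val x := by
      simp [increment]
    have hQ0 (h : History n) : 0 ≤ ∑ i, increment w h i ^ 2 :=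
      Finset.sum_nonneg fun i _ => sq_nonneg _
    have key (s : History n → ℝ) (hs : ∀ h, 0 ≤ s h) (hsm : Measurable s) :
        ∫⁻ h, ∫⁻ x, ENNReal.ofReal (s h + 4 * (w (n + 1)).val x ^ 2) ∂(π.select n h)
          ∂(historyLaw (biasedEnv b) π n) =
        ∫⁻ h, ENNReal.ofReal (s h) ∂(historyLaw (biasedEnv b) π n) +
        ∫⁻ h, ∫⁻ x, ENNReal.ofReal (4 * (w (n + 1)).val x ^ 2) ∂(π.select n h)
          ∂(historyLaw (biasedEnv b) π n) := by
      rw [← lintegral_add_left (by fun_prop)]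
      refine lintegral_congr fun h => ?_
      have : ∀ x, ENNReal.ofReal (s h + 4 * (w (n + 1)).val x ^ 2) =
          ENNReal.ofReal (s h) + ENNReal.ofReal (4 * (w (n + 1)).val x ^ 2) := fun x =>
        ENNReal.ofReal_add (hs h) (by positivity)
      simp_rw [this]
      rw [lintegral_add_left measurable_const]
      simp
    have l1 : ∀ h : History n, ∀ x : Arm,
        ENNReal.ofReal (1 / 2 + (b (n + 1)).val x) *
            ENNReal.ofReal ((∑ i, increment w (History.append (h, x, 1)) i) ^ 2) +
          ENNReal.ofReal (1 / 2 - (b (n + 1)).val x) *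
            ENNReal.ofReal ((∑ i, increment w (History.append (h, x, 0)) i) ^ 2) =
        ENNReal.ofReal ((∑ i, increment w h i) ^ 2 + 4 * (w (n + 1)).val x ^ 2) := fun h x => by
      rw [← ENNReal.ofReal_mul (hb x), ← ENNReal.ofReal_mul (hb' x), ← ENNReal.ofReal_add
        (mul_nonneg (hb x) (sq_nonneg _)) (mul_nonneg (hb' x) (sq_nonneg _))]
      congr 1
      simp only [Fin.sum_univ_castSucc, increment_castSucc, i1, i0]
      linear_combination 8 * (∑ i, increment w h i) * hbw (n + 1) x
    have l2 : ∀ h : History n, ∀ x : Arm,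
        ENNReal.ofReal (1 / 2 + (b (n + 1)).val x) *
            ENNReal.ofReal (∑ i, increment w (History.append (h, x, 1)) i ^ 2) +
          ENNReal.ofReal (1 / 2 - (b (n + 1)).val x) *
            ENNReal.ofReal (∑ i, increment w (History.append (h, x, 0)) i ^ 2) =
        ENNReal.ofReal (∑ i, increment w h i ^ 2 + 4 * (w (n + 1)).val x ^ 2) := fun h x => by
      rw [← ENNReal.ofReal_mul (hb x), ← ENNReal.ofReal_mul (hb' x), ← ENNReal.ofReal_add
        (mul_nonneg (hb x) (Finset.sum_nonneg fun i _ => sq_nonneg _))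
        (mul_nonneg (hb' x) (Finset.sum_nonneg fun i _ => sq_nonneg _))]
      congr 1
      simp only [Fin.sum_univ_castSucc, increment_castSucc, i1, i0]
      ring
    simp_rw [l1, l2]
    rw [key _ (fun h => sq_nonneg _) ((hS n).pow_const 2), key _ hQ0 (hQ n), ih]

/-! ### Significant shifts and total variation of piecewise constant environments -/

lemma significantShift_succ_spec (e : Environment) (T i : ℕ)
    (h : significantShift e T (i + 1) ≠ ⊤) :
    ∃ n a : ℕ, significantShift e T (i + 1) = n ∧ significantShift e T i = a ∧ a < n ∧ n ≤ T ∧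
      AllUnsafe e T a n := by
  rw [significantShift] at h ⊢
  have hne : {b : ℕ∞ | ∃ n a : ℕ, b = n ∧ significantShift e T i = a ∧ a < n ∧ n ≤ T ∧
      AllUnsafe e T a n}.Nonempty :=
    Set.nonempty_iff_ne_empty.mpr fun h0 => h (by rw [h0, sInf_empty])
  exact csInf_mem hne

lemma significantShift_mono (e : Environment) (T : ℕ) : Monotone (significantShift e T) := by
  refine monotone_nat_of_le_succ fun i => ?_
  by_cases h : significantShift e T (i + 1) = ⊤
  · simp [h]
  · obtain ⟨n, a, hn, ha, han, -⟩ := significantShift_succ_spec e T i h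
    rw [hn, ha]; exact_mod_cast han.le

/-- Each significant shift `τ_{i+1}` needs a change of the mean rewards between `τ_i` and
`τ_{i+1}`, because otherwise an arm that is optimal in round `τ_i` remains safe. -/
lemma numSignificantShifts_le_card (e : Environment) (T : ℕ) (D : Finset ℕ)
    (hD : ∀ t, 1 ≤ t → t < T → t ∉ D → e.mean (t + 1) = e.mean t)
    (hopt : ∀ t, ∃ x, e.gap t x = 0) : numSignificantShifts e T ≤ D.card := by
  have hchange : ∀ i, significantShift e T (i + 1) ≠ ⊤ → ∃ t ∈ D,
      significantShift e T i ≤ t ∧ (t : ℕ∞) < significantShift e T (i + 1) := by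
    intro i hi
    obtain ⟨n, a, hn, ha, han, hnT, hall⟩ := significantShift_succ_spec e T i hi
    have ha1 : 1 ≤ a := by
      have := significantShift_mono e T (Nat.zero_le i)
      rw [ha, significantShift] at this
      exact_mod_cast this
    by_contra hno
    push Not at hno
    rw [hn, ha] at hno
    have hconst : ∀ t, a ≤ t → t ≤ n → e.mean t = e.mean a := by
      intro t hat
      induction t, hat using Nat.le_induction with
      | base => intro _; rfl
      | succ t hat ih =>
        intro htn
        rw [← ih (by omega)]
        refine hD t (by omega) (by omega) fun htD => ?_
        have := hno t htD (by exact_mod_cast hat)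
        have : n ≤ t := by exact_mod_cast this
        omega
    obtain ⟨x, hx⟩ := hopt a
    obtain ⟨s₁, s₂, h1, h2, hlt, hle⟩ := hall x
    have hsum : ∑ t ∈ Finset.Icc s₁ s₂, e.gap t x = 0 := by
      refine Finset.sum_eq_zero fun t ht => ?_
      rw [Finset.mem_Icc] at ht
      rw [← hx, Environment.gap, Environment.gap, hconst t (by omega) (by omega)]
    have hlog : 0 < Real.log T := Real.log_pos (by
      have : 1 < T := by omega
      exact_mod_cast this)
    have hpow : 0 < ((s₂ : ℝ) - s₁) ^ (2 / 3 : ℝ) :=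
      Real.rpow_pos_of_pos (sub_pos.mpr (by exact_mod_cast hlt)) _
    rw [hsum] at hle
    exact absurd hle (not_le.mpr (mul_pos hlog hpow))
  choose! g hgD hg1 hg2 using hchange
  have hmaps : Set.MapsTo (fun i => g (i - 1)) {i : ℕ | 1 ≤ i ∧ significantShift e T i ≠ ⊤}
      (D : Set ℕ) := by
    rintro i ⟨hi, hne⟩
    obtain ⟨j, rfl⟩ := Nat.exists_eq_add_of_le' hi
    exact hgD j hne
  have hlt : ∀ i j, significantShift e T (i + 1) ≠ ⊤ → significantShift e T (j + 1) ≠ ⊤ →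
      i < j → g i < g j := by
    intro i j hi hj hij
    have := (hg2 i hi).trans_le ((significantShift_mono e T hij).trans (hg1 j hj))
    exact_mod_cast this
  have hinj : Set.InjOn (fun i => g (i - 1)) {i : ℕ | 1 ≤ i ∧ significantShift e T i ≠ ⊤} := by
    rintro i ⟨hi, hne⟩ j ⟨hj, hnj⟩ hij
    obtain ⟨i, rfl⟩ := Nat.exists_eq_add_of_le' hi
    obtain ⟨j, rfl⟩ := Nat.exists_eq_add_of_le' hj
    simp only [Nat.add_sub_cancel] at hij
    rcases lt_trichotomy i j with h | h | h
    · exact absurd hij (hlt i j hne hnj h).ne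
    · rw [h]
    · exact absurd hij (hlt j i hnj hne h).ne'
  have := Set.encard_le_encard_of_injOn hmaps hinj
  rwa [Set.encard_coe_eq_coe_finsetCard] at this

lemma totalVariation_le_card_mul (e : Environment) (T : ℕ) (D : Finset ℕ) {v : ℝ} (hv : 0 ≤ v)
    (hD : ∀ t, 1 ≤ t → t < T → t ∉ D → e.mean (t + 1) = e.mean t)
    (hle : ∀ t x, |e.mean (t + 1) x - e.mean t x| ≤ v) :
    totalVariation e T ≤ D.card * v := by
  have hstep : ∀ t ∈ Finset.Ico 1 T,
      (⨆ x : Arm, |e.mean (t + 1) x - e.mean t x|) ≤ if t ∈ D then v else 0 := by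
    intro t ht
    rw [Finset.mem_Ico] at ht
    split_ifs with h
    · exact ciSup_le fun x => hle t x
    · simp [hD t ht.1 ht.2 h]
  calc totalVariation e T ≤ ∑ t ∈ Finset.Ico 1 T, if t ∈ D then v else 0 :=
        Finset.sum_le_sum hstep
    _ = ((Finset.Ico 1 T).filter (· ∈ D)).card * v := by
        rw [← Finset.sum_filter, Finset.sum_const, nsmul_eq_mul]
    _ ≤ D.card * v := by
        gcongr
        intro t ht
        exact (Finset.mem_filter.mp ht).2

/-! ### Averaging over the coordinates of a vector -/

lemma sum_sum_update {ι κ : Type*} [Fintype ι] [DecidableEq ι] [Fintype κ] (j : ι)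
    (G : (ι → κ) → ℝ) :
    ∑ k : ι → κ, ∑ a, G (Function.update k j a) = Fintype.card κ * ∑ k, G k := by
  -- exchanging the entry `j` of `k` with `a` is an involution of the pairs `(k, a)`
  have hinv : Function.Involutive
      fun p : (ι → κ) × κ => (Function.update p.1 j p.2, p.1 j) := fun p => by simp
  calc ∑ k : ι → κ, ∑ a, G (Function.update k j a)
      = ∑ p : (ι → κ) × κ, G (Function.update p.1 j p.2) := by rw [Fintype.sum_prod_type]
    _ = ∑ p : (ι → κ) × κ, G p.1 := Equiv.sum_comp hinv.toPerm fun p => G p.1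
    _ = Fintype.card κ * ∑ k, G k := by
        rw [Fintype.sum_prod_type]; simp [Finset.mul_sum]

/-- If each term `F j` is at least `c` on average over the coordinate `j` alone, then some vector
makes the sum of all terms at least `card ι * c`. -/
lemma exists_card_mul_le_sum {ι κ : Type*} [Fintype ι] [DecidableEq ι] [Fintype κ] [Nonempty κ]
    (F : ι → (ι → κ) → ℝ) (c : ℝ)
    (h : ∀ j k, Fintype.card κ * c ≤ ∑ a, F j (Function.update k j a)) :
    ∃ k, Fintype.card ι * c ≤ ∑ j, F j k := by
  have hκ : (0 : ℝ) < Fintype.card κ := by exact_mod_cast Fintype.card_pos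
  have h1 : ∀ j, ∑ _k : ι → κ, c ≤ ∑ k, F j k := fun j => by
    refine le_of_mul_le_mul_left ?_ hκ
    rw [← sum_sum_update j (F j), Finset.mul_sum]
    exact Finset.sum_le_sum fun k _ => h j k
  have h2 : ∑ _k : ι → κ, Fintype.card ι * c ≤ ∑ k, ∑ j, F j k := by
    rw [Finset.sum_comm]
    refine le_trans (le_of_eq ?_) (Finset.sum_le_sum fun j _ => h1 j)
    simp only [Finset.sum_const, nsmul_eq_mul, Finset.card_univ]; ring
  obtain ⟨k, -, hk⟩ := Finset.exists_le_of_sum_le Finset.univ_nonempty h2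
  exact ⟨k, hk⟩

/-! ### Hits of a set of arms within a block of rounds -/

/-- The number of rounds in `B` in which an arm of `A` is played. -/
noncomputable def hits {T : ℕ} (B : Finset (Fin T)) (A : Set Arm) (h : History T) : ℝ :=
  ∑ i ∈ B, A.indicator 1 (h i).1

lemma hits_nonneg {T : ℕ} (B : Finset (Fin T)) (A : Set Arm) (h : History T) : 0 ≤ hits B A h :=
  Finset.sum_nonneg fun _ _ => Set.indicator_nonneg (fun _ _ => zero_le_one) _

lemma hits_le_card {T : ℕ} (B : Finset (Fin T)) (A : Set Arm) (h : History T) :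
    hits B A h ≤ B.card := by
  have : hits B A h ≤ ∑ i ∈ B, (1 : ℝ) :=
    Finset.sum_le_sum fun _ _ => Set.indicator_le_self' (fun _ _ => zero_le_one) _
  simpa using this

lemma measurable_hits {T : ℕ} (B : Finset (Fin T)) {A : Set Arm} (hA : MeasurableSet A) :
    Measurable (hits B A) := by
  unfold hits
  have : Measurable (A.indicator (1 : Arm → ℝ)) := measurable_one.indicator hA
  fun_prop

lemma integrable_hits {T : ℕ} (B : Finset (Fin T)) {A : Set Arm} (hA : MeasurableSet A)
    (P : Measure (History T)) [IsProbabilityMeasure P] : Integrable (hits B A) P :=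
  Integrable.of_bound (measurable_hits B hA).aestronglyMeasurable B.card
    (ae_of_all _ fun h => by
      rw [Real.norm_of_nonneg (hits_nonneg B A h)]; exact hits_le_card B A h)

lemma le_log_one_add {z : ℝ} (hz : |z| ≤ 1 / 2) : z - 2 * z ^ 2 ≤ Real.log (1 + z) := by
  have h := abs_le.mp hz
  have hpos : 0 < 1 + z := by linarith
  refine le_trans ?_ (Real.one_sub_inv_le_log_of_pos hpos)
  have : 1 - (1 + z)⁻¹ - (z - 2 * z ^ 2) = z ^ 2 * (1 + 2 * z) / (1 + z) := by
    field_simp; ring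
  have h2 : 0 ≤ z ^ 2 * (1 + 2 * z) / (1 + z) :=
    div_nonneg (mul_nonneg (sq_nonneg z) (by linarith)) hpos.le
  linarith

lemma le_prod_one_add {ι : Type*} (s : Finset ι) (z : ι → ℝ) (hz : ∀ i ∈ s, |z i| ≤ 1 / 2) :
    7 / 8 - 2 * (∑ i ∈ s, z i) ^ 2 - 2 * ∑ i ∈ s, z i ^ 2 ≤ ∏ i ∈ s, (1 + z i) := by
  have hpos : ∀ i ∈ s, 0 < 1 + z i := fun i hi => by
    have := (abs_le.mp (hz i hi)).1; linarith
  have h1 : ∑ i ∈ s, z i - 2 * ∑ i ∈ s, z i ^ 2 ≤ Real.log (∏ i ∈ s, (1 + z i)) := by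
    rw [Real.log_prod fun i hi => (hpos i hi).ne', Finset.mul_sum, ← Finset.sum_sub_distrib]
    exact Finset.sum_le_sum fun i hi => le_log_one_add (hz i hi)
  have h2 := Real.log_le_sub_one_of_pos (Finset.prod_pos hpos)
  -- `∑ z i ≥ - 1 / 8 - 2 (∑ z i) ^ 2` trades the signed sum for its square
  nlinarith [sq_nonneg (4 * ∑ i ∈ s, z i + 1)]

/-- Raising the mean rewards by at most `ε`, on the arms of `A` and in the rounds of `B` only, can
hardly make an algorithm play `A` in those rounds if it rarely did so before. -/
lemma le_integral_misses {b b' w : ℕ → Bias}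
    (hw : ∀ t x, (b' t).val x = (b t).val x + (w t).val x)
    (hbw : ∀ t x, (b t).val x * (w t).val x = 0) (π : Algorithm) {T : ℕ} (B : Finset (Fin T))
    {A : Set Arm} (hA : MeasurableSet A) {ε : ℝ} (hε0 : 0 ≤ ε) (hε : ε ≤ 1 / 4)
    (hwB : ∀ i : Fin T, i ∉ B → ∀ x, (w (i + 1)).val x = 0)
    (hwA : ∀ t x, |(w t).val x| ≤ ε * A.indicator 1 x) :
    7 / 8 * B.card ≤
      ∫ h, (B.card - hits B A h) ∂(historyLaw (biasedEnv b') π T) +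
        (1 + 16 * B.card * ε ^ 2) * ∫ h, hits B A h ∂(historyLaw (biasedEnv b) π T) := by
  set P := historyLaw (biasedEnv b) π T
  set P' := historyLaw (biasedEnv b') π T
  set c : ℝ := (B.card : ℝ)
  have hc0 : 0 ≤ c := Nat.cast_nonneg _
  have hN0 := hits_nonneg B A
  have hNc := hits_le_card B A
  have hind (x : Arm) : 0 ≤ A.indicator (1 : Arm → ℝ) x ∧ A.indicator (1 : Arm → ℝ) x ≤ 1 :=
    ⟨Set.indicator_nonneg (fun _ _ => zero_le_one) x,
      Set.indicator_le_self' (f := (1 : Arm → ℝ)) (fun _ _ => zero_le_one) x⟩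
  have hz (h : History T) (i : Fin T) :
      |increment w h i| ≤ 2 * ε * A.indicator 1 (h i).1 := by
    have h1 := hwA (i + 1) (h i).1
    have h2 : |2 * ((h i).2 : ℝ) - 1| ≤ 1 := by
      have := (h i).2.2
      rw [abs_le]; constructor <;> linarith [this.1, this.2]
    rw [increment, abs_mul, abs_mul, abs_two]
    nlinarith [abs_nonneg ((w (i + 1)).val (h i).1), abs_nonneg (2 * ((h i).2 : ℝ) - 1)]
  have hQ (h : History T) : ∑ i, increment w h i ^ 2 ≤ 4 * ε ^ 2 * hits B A h := by
    have hsub : ∑ i, increment w h i ^ 2 = ∑ i ∈ B, increment w h i ^ 2 :=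
      (Finset.sum_subset (Finset.subset_univ B) fun i _ hi => by
        simp [increment, hwB i hi]).symm
    rw [hsub, hits, Finset.mul_sum]
    refine Finset.sum_le_sum fun i _ => ?_
    have h1 := hz h i
    have h2 := hind (h i).1
    rw [← sq_abs]
    calc |increment w h i| ^ 2 ≤ (2 * ε * A.indicator 1 (h i).1) ^ 2 := by gcongr
      _ = 4 * ε ^ 2 * (A.indicator 1 (h i).1 * A.indicator 1 (h i).1) := by ring
      _ ≤ 4 * ε ^ 2 * (A.indicator 1 (h i).1 * 1) := by
          have := h2.1
          gcongr
          exact h2.2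
      _ = _ := by ring
  have hL0 (h : History T) : 0 ≤ ∏ i, (1 + increment w h i) :=
    Finset.prod_nonneg fun i _ => one_add_increment_nonneg w h i
  have hpt (h : History T) : 7 / 8 * c ≤ (∏ i, (1 + increment w h i)) * (c - hits B A h) +
      (1 + 8 * c * ε ^ 2) * hits B A h + 2 * c * (∑ i, increment w h i) ^ 2 := by
    have hL := le_prod_one_add Finset.univ (increment w h) fun i _ => by
      have h1 := hz h i
      have h2 := hind (h i).1
      nlinarith
    have hM : 0 ≤ c - hits B A h := by linarith [hNc h]
    have h3 := mul_le_mul_of_nonneg_right hL hM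
    have h4 := hQ h
    have h5 := hN0 h
    have hS0 := sq_nonneg (∑ i, increment w h i)
    have hQ0 : 0 ≤ ∑ i, increment w h i ^ 2 := Finset.sum_nonneg fun i _ => sq_nonneg _
    nlinarith [mul_nonneg h5 hS0, mul_nonneg h5 hQ0, mul_le_mul_of_nonneg_left h4 hc0]
  have hmN := measurable_hits B hA
  have hmS : Measurable fun h : History T => ∑ i, increment w h i :=
    Finset.measurable_fun_sum _ fun i _ => measurable_increment w i
  have hmL : Measurable fun h : History T => ∏ i, (1 + increment w h i) :=
    Finset.measurable_fun_prod _ fun i _ => (measurable_increment w i).const_add 1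
  have hIN : Integrable (hits B A) P := integrable_hits B hA P
  have hIM : Integrable (fun h => c - hits B A h) P' :=
    (integrable_const _).sub (integrable_hits B hA P')
  have hIN0 : 0 ≤ ∫ h, hits B A h ∂P := integral_nonneg hN0
  have hM0 (h : History T) : 0 ≤ c - hits B A h := by linarith [hNc h]
  have hIM0 : 0 ≤ ∫ h, (c - hits B A h) ∂P' := integral_nonneg hM0
  have eM : ∫⁻ h, ENNReal.ofReal (∏ i, (1 + increment w h i)) *
      ENNReal.ofReal (c - hits B A h) ∂P = ENNReal.ofReal (∫ h, (c - hits B A h) ∂P') := by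
    rw [← lintegral_historyLaw_eq_density hw hbw π T
      (f := fun h => ENNReal.ofReal (c - hits B A h)) (by fun_prop),
      ofReal_integral_eq_lintegral_ofReal hIM (ae_of_all _ hM0)]
  have eN : ∫⁻ h, ENNReal.ofReal (hits B A h) ∂P = ENNReal.ofReal (∫ h, hits B A h ∂P) :=
    (ofReal_integral_eq_lintegral_ofReal hIN (ae_of_all _ hN0)).symm
  have eS : ∫⁻ h, ENNReal.ofReal ((∑ i, increment w h i) ^ 2) ∂P ≤
      ENNReal.ofReal (4 * ε ^ 2 * ∫ h, hits B A h ∂P) := by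
    rw [lintegral_sum_increment_sq hbw]
    refine (lintegral_mono fun h => ENNReal.ofReal_le_ofReal (hQ h)).trans (le_of_eq ?_)
    rw [ENNReal.ofReal_mul (by positivity), ← eN, ← lintegral_const_mul _ (by fun_prop)]
    exact lintegral_congr fun h => ENNReal.ofReal_mul (by positivity)
  have hfin : ENNReal.ofReal (7 / 8 * c) ≤ ENNReal.ofReal
      (∫ h, (c - hits B A h) ∂P' + (1 + 8 * c * ε ^ 2) * ∫ h, hits B A h ∂P +
        2 * c * (4 * ε ^ 2 * ∫ h, hits B A h ∂P)) := by
    calc ENNReal.ofReal (7 / 8 * c) = ∫⁻ _h, ENNReal.ofReal (7 / 8 * c) ∂P := by simp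
      _ ≤ ∫⁻ h, (ENNReal.ofReal (∏ i, (1 + increment w h i)) * ENNReal.ofReal (c - hits B A h) +
            ENNReal.ofReal (1 + 8 * c * ε ^ 2) * ENNReal.ofReal (hits B A h) +
            ENNReal.ofReal (2 * c) * ENNReal.ofReal ((∑ i, increment w h i) ^ 2)) ∂P := by
          refine lintegral_mono fun h => ?_
          have h0 := hL0 h
          have h1 := hM0 h
          have h2 := hN0 h
          simp only
          rw [← ENNReal.ofReal_mul h0, ← ENNReal.ofReal_mul (by positivity),
            ← ENNReal.ofReal_mul (by positivity), ← ENNReal.ofReal_add (by positivity)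
            (by positivity), ← ENNReal.ofReal_add (by positivity) (by positivity)]
          exact ENNReal.ofReal_le_ofReal (hpt h)
      _ ≤ _ := by
          rw [lintegral_add_left (by fun_prop), lintegral_add_left (by fun_prop),
            lintegral_const_mul _ (by fun_prop), lintegral_const_mul _ (by fun_prop), eM, eN,
            ENNReal.ofReal_add (q := 2 * c * (4 * ε ^ 2 * ∫ h, hits B A h ∂P)) (by positivity)
              (by positivity),
            ENNReal.ofReal_add hIM0 (by positivity), ENNReal.ofReal_mul (p := 2 * c)
            (by positivity), ENNReal.ofReal_mul (p := 1 + 8 * c * ε ^ 2) (by positivity)]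
          gcongr
  have := (ENNReal.ofReal_le_ofReal_iff (by positivity)).mp hfin
  linarith

/-! ### Bumps and block environments -/

/-- The tent of height and half-width `1 / (2 K)` in the cell `[k / K, (k + 1) / K]`. -/
noncomputable def tent {K : ℕ} (k : Fin K) (x : Arm) : ℝ :=
  max 0 (1 / (2 * K) - |(x : ℝ) - (2 * k + 1) / (2 * K)|)

lemma tent_nonneg {K : ℕ} (k : Fin K) (x : Arm) : 0 ≤ tent k x := le_max_left _ _

lemma tent_le {K : ℕ} (k : Fin K) (x : Arm) : tent k x ≤ 1 / (2 * K) :=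
  max_le (by positivity) (by linarith [abs_nonneg ((x : ℝ) - (2 * k + 1) / (2 * K))])

lemma exists_tent_eq {K : ℕ} (k : Fin K) : ∃ x, tent k x = 1 / (2 * K) := by
  have hk : (k : ℝ) + 1 ≤ K := by exact_mod_cast k.2
  have hK : (0 : ℝ) < K := by linarith [(Nat.cast_nonneg k.1 : (0 : ℝ) ≤ k.1)]
  refine ⟨⟨(2 * k + 1) / (2 * K), by positivity, ?_⟩, ?_⟩
  · rw [div_le_one (by positivity)]; linarith
  · simp [tent]

lemma tent_eq_zero_of_ne {K : ℕ} {k l : Fin K} (hkl : k ≠ l) {x : Arm} (hk : tent k x ≠ 0) :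
    tent l x = 0 := by
  have hK : (0 : ℝ) < K := by exact_mod_cast k.pos
  -- the centres of two distinct tents are at distance at least `1 / K`
  have hsep : 1 / (K : ℝ) ≤ |(2 * (k : ℝ) + 1) / (2 * K) - (2 * l + 1) / (2 * K)| := by
    have h1 : (1 : ℝ) ≤ |(k : ℝ) - l| := by
      have : (k : ℤ) - l ≠ 0 := fun h => hkl (Fin.ext (by omega))
      exact_mod_cast Int.one_le_abs this
    have h2 : (2 * (k : ℝ) + 1) / (2 * K) - (2 * l + 1) / (2 * K) = (k - l) / K := by
      field_simp; ring
    rw [h2, abs_div, abs_of_pos hK]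
    gcongr
  have h3 : |(x : ℝ) - (2 * k + 1) / (2 * K)| < 1 / (2 * K) := by
    by_contra h
    exact hk (max_eq_left (by linarith))
  refine max_eq_left ?_
  have h4 := abs_sub_le ((2 * (k : ℝ) + 1) / (2 * K)) x ((2 * (l : ℝ) + 1) / (2 * K))
  rw [abs_sub_comm _ (x : ℝ)] at h4
  have h5 : 1 / (K : ℝ) = 1 / (2 * K) + 1 / (2 * K) := by field_simp; norm_num
  linarith

/-- The bias given by the `k`-th tent, or the zero bias for `none`. -/
noncomputable def bump {K : ℕ} (o : Option (Fin K)) : Bias where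
  val x := o.elim 0 fun k => tent k x
  abs_le x := by
    cases o with
    | none => norm_num
    | some k =>
      have hK : (1 : ℝ) ≤ K := by exact_mod_cast k.pos
      simp only [Option.elim_some]
      rw [abs_of_nonneg (tent_nonneg k x)]
      refine (tent_le k x).trans ?_
      gcongr
      linarith
  lipschitz x x' := by
    cases o with
    | none => simp
    | some k =>
      simp only [Option.elim_some, tent]
      refine (abs_max_sub_max_le_max _ _ _ _).trans ?_
      rw [sub_self, abs_zero, max_eq_right (abs_nonneg _), sub_sub_sub_cancel_left]
      refine (abs_abs_sub_abs_le_abs_sub _ _).trans (le_of_eq ?_)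
      rw [abs_sub_comm]
      congr 1
      ring

@[simp] lemma bump_none_val {K : ℕ} (x : Arm) : (bump (none : Option (Fin K))).val x = 0 := rfl

@[simp] lemma bump_some_val {K : ℕ} (k : Fin K) (x : Arm) : (bump (some k)).val x = tent k x := rfl

lemma bump_val_nonneg {K : ℕ} (o : Option (Fin K)) (x : Arm) : 0 ≤ (bump o).val x := by
  cases o with
  | none => simp
  | some k => exact tent_nonneg k x

lemma bump_val_le {K : ℕ} (o : Option (Fin K)) (x : Arm) : (bump o).val x ≤ 1 / (2 * K) := by
  cases o with
  | none => simp
  | some k => exact tent_le k x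

/-- The arms on which the `k`-th tent is nonzero. -/
def cell {K : ℕ} (k : Fin K) : Set Arm := {x | tent k x ≠ 0}

lemma measurableSet_cell {K : ℕ} (k : Fin K) : MeasurableSet (cell k) :=
  ((bump (some k)).measurable (measurableSet_singleton (0 : ℝ))).compl

lemma sum_indicator_cell_le {K : ℕ} (x : Arm) :
    ∑ k : Fin K, (cell k).indicator (1 : Arm → ℝ) x ≤ 1 := by
  by_cases h : ∃ k : Fin K, x ∈ cell k
  · obtain ⟨k, hk⟩ := h
    rw [Finset.sum_eq_single k _ (by simp)]
    · simp [hk]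
    · intro l _ hl
      have : x ∉ cell l := fun hx => hx (tent_eq_zero_of_ne hl.symm hk)
      simp [this]
  · push Not at h
    simp [h]

lemma sum_hits_cell_le {T K : ℕ} (B : Finset (Fin T)) (h : History T) :
    ∑ k : Fin K, hits B (cell k) h ≤ B.card := by
  simp only [hits]
  rw [Finset.sum_comm]
  calc ∑ i ∈ B, ∑ k : Fin K, (cell k).indicator (1 : Arm → ℝ) (h i).1 ≤ ∑ _i ∈ B, (1 : ℝ) :=
        Finset.sum_le_sum fun i _ => sum_indicator_cell_le _
    _ = B.card := by simp

/-- The biases of an environment which, in the `j`-th block of `n` rounds, that is the rounds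
`n j + 1, …, n j + n`, keeps the bump `c j`. -/
noncomputable def blockBias {K : ℕ} (n : ℕ) (c : ℕ → Option (Fin K)) (t : ℕ) : Bias :=
  bump (c ((t - 1) / n))

/-- The indices of the rounds of the `j`-th block of `n` rounds; the index `i` stands for the round
`i + 1`. -/
def block (T n j : ℕ) : Finset (Fin T) := Finset.univ.filter fun i => (i : ℕ) / n = j

lemma card_block {T n j : ℕ} (hn : 1 ≤ n) (h : n * (j + 1) ≤ T) : (block T n j).card = n := by
  rw [block, Finset.card_filter, Fin.sum_univ_eq_sum_range (fun i => if i / n = j then 1 else 0) T,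
    ← Finset.card_filter]
  have : (Finset.range T).filter (fun i => i / n = j) = Finset.Ico (n * j) (n * (j + 1)) := by
    ext i
    simp only [Finset.mem_filter, Finset.mem_range, Finset.mem_Ico]
    rw [Nat.div_eq_iff (by omega)]
    rw [mul_add, mul_one] at *
    rw [mul_comm j n]
    omega
  rw [this, Nat.card_Ico, mul_add, mul_one]
  omega

/-- For a bump placed at random in one block, an algorithm is expected to miss it in a constant
fraction of the rounds, as long as `n` is small compared with `K ^ 3`. -/
lemma le_sum_integral_misses {K : ℕ} (hK : 2 ≤ K) (π : Algorithm) {T n j : ℕ} (hn : 1 ≤ n)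
    (hj : n * (j + 1) ≤ T) (c : ℕ → Option (Fin K)) :
    (n : ℝ) * K * (7 / 8) - (1 + 4 * n / (K : ℝ) ^ 2) * n ≤
      ∑ k : Fin K, ∫ h, ((n : ℝ) - hits (block T n j) (cell k) h)
        ∂(historyLaw (biasedEnv (blockBias n (Function.update c j (some k)))) π T) := by
  have hcard := card_block hn hj
  have hK' : (2 : ℝ) ≤ K := by exact_mod_cast hK
  set P := historyLaw (biasedEnv (blockBias n (Function.update c j none))) π T
  have hone (k : Fin K) : 7 / 8 * (n : ℝ) ≤
      ∫ h, ((n : ℝ) - hits (block T n j) (cell k) h)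
        ∂(historyLaw (biasedEnv (blockBias n (Function.update c j (some k)))) π T) +
      (1 + 4 * n / (K : ℝ) ^ 2) * ∫ h, hits (block T n j) (cell k) h ∂P := by
    have := le_integral_misses (b := blockBias n (Function.update c j none))
      (b' := blockBias n (Function.update c j (some k)))
      (w := blockBias n (Function.update (fun _ => none) j (some k))) (T := T)
      (fun t x => ?_) (fun t x => ?_) π (block T n j) (measurableSet_cell k)
      (ε := 1 / (2 * K)) (by positivity) ?_ (fun i hi x => ?_) (fun t x => ?_)
    · rw [hcard] at this
      convert this using 3
      field_simp
      ring
    · by_cases h : (t - 1) / n = j <;> simp [blockBias, h]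
    · by_cases h : (t - 1) / n = j <;> simp [blockBias, h]
    · rw [div_le_div_iff₀ (by positivity) (by norm_num)]; linarith
    · have : (i : ℕ) / n ≠ j := by simpa [block] using hi
      simp [blockBias, this]
    · by_cases h : (t - 1) / n = j
      · simp only [blockBias, h, Function.update_self, bump_some_val]
        by_cases hx : x ∈ cell k
        · simpa [hx, abs_of_nonneg (tent_nonneg k x)] using tent_le k x
        · have h0 : tent k x = 0 := by simpa [cell] using hx
          simp [hx, h0]
      · simp only [blockBias, ne_eq, h, not_false_eq_true, Function.update_of_ne, bump_none_val,
          abs_zero]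
        exact mul_nonneg (by positivity) (Set.indicator_nonneg (fun _ _ => zero_le_one) x)
  have hsum := Finset.sum_le_sum fun k (_ : k ∈ (Finset.univ : Finset (Fin K))) => hone k
  have hlin : ∑ k : Fin K, (1 + 4 * n / (K : ℝ) ^ 2) * ∫ h, hits (block T n j) (cell k) h ∂P =
      (1 + 4 * n / (K : ℝ) ^ 2) * ∫ h, ∑ k : Fin K, hits (block T n j) (cell k) h ∂P := by
    rw [← Finset.mul_sum, integral_finsetSum _ fun k _ =>
      integrable_hits (block T n j) (measurableSet_cell k) P]
  rw [Finset.sum_add_distrib, hlin, Finset.sum_const, Finset.card_univ, Fintype.card_fin,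
    nsmul_eq_mul] at hsum
  have hhits : ∫ h, ∑ k : Fin K, hits (block T n j) (cell k) h ∂P ≤ n := by
    have := integral_mono (μ := P) (integrable_finsetSum _ fun k _ =>
      integrable_hits (block T n j) (measurableSet_cell k) P) (integrable_const (n : ℝ))
      fun h => by simpa [hcard] using sum_hits_cell_le (K := K) (block T n j) h
    simpa using this
  have h1 : (0 : ℝ) ≤ 1 + 4 * n / (K : ℝ) ^ 2 := by positivity
  have := mul_le_mul_of_nonneg_left hhits h1
  linarith

/-! ### Gaps and regret -/

lemma bddAbove_range_mean (b : ℕ → Bias) (t : ℕ) : BddAbove (Set.range ((biasedEnv b).mean t)) := by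
  refine ⟨1, ?_⟩
  rintro _ ⟨x, rfl⟩
  rw [biasedEnv_mean]
  linarith [(b t).half_sub_nonneg x]

lemma gap_nonneg (b : ℕ → Bias) (t : ℕ) (x : Arm) : 0 ≤ (biasedEnv b).gap t x :=
  sub_nonneg.mpr (le_ciSup (bddAbove_range_mean b t) x)

lemma measurable_gap (b : ℕ → Bias) (t : ℕ) : Measurable ((biasedEnv b).gap t) := by
  have := (b t).measurable
  unfold Environment.gap
  simp only [biasedEnv_mean]
  fun_prop

lemma gap_le_one (b : ℕ → Bias) (t : ℕ) (x : Arm) : (biasedEnv b).gap t x ≤ 1 := by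
  have h1 : ⨆ x', (biasedEnv b).mean t x' ≤ 1 := ciSup_le fun x' => by
    rw [biasedEnv_mean]; linarith [(b t).half_sub_nonneg x']
  rw [Environment.gap, biasedEnv_mean]
  linarith [(b t).half_add_nonneg x]

/-- The supremum in the gap is attained, as the mean rewards are continuous on a compact set. -/
lemma exists_gap_eq_zero (b : ℕ → Bias) (t : ℕ) : ∃ x, (biasedEnv b).gap t x = 0 := by
  obtain ⟨x, -, hx⟩ := isCompact_univ.exists_isMaxOn (Set.univ_nonempty (α := Arm))
    (b t).continuous.continuousOn
  refine ⟨x, le_antisymm (sub_nonpos.mpr (ciSup_le fun x' => ?_)) (gap_nonneg b t x)⟩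
  rw [biasedEnv_mean, biasedEnv_mean]
  linarith [isMaxOn_iff.mp hx x' (Set.mem_univ _)]

lemma le_gap_blockBias {K n : ℕ} {c : ℕ → Option (Fin K)} {t : ℕ} {k : Fin K}
    (hc : c ((t - 1) / n) = some k) (x : Arm) :
    1 / (2 * K) * (1 - (cell k).indicator 1 x) ≤ (biasedEnv (blockBias n c)).gap t x := by
  by_cases hx : x ∈ cell k
  · simpa [hx] using gap_nonneg (blockBias n c) t x
  · obtain ⟨y, hy⟩ := exists_tent_eq k
    have h0 : tent k x = 0 := by simpa [cell] using hx
    have := le_ciSup (bddAbove_range_mean (blockBias n c) t) y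
    rw [biasedEnv_mean] at this
    simp only [blockBias, hc, bump_some_val, hy] at this
    rw [Environment.gap, biasedEnv_mean]
    simp only [blockBias, hc, bump_some_val, h0, hx, not_false_eq_true, Set.indicator_of_notMem]
    linarith

/-- The bumps `k 0, …, k (J - 1)` in the first `J` blocks, followed by no bump. -/
def bumpSeq {J K : ℕ} (k : Fin J → Fin K) (j : ℕ) : Option (Fin K) :=
  if h : j < J then some (k ⟨j, h⟩) else none

lemma bumpSeq_update {J K : ℕ} (k : Fin J → Fin K) (j : Fin J) (a : Fin K) :
    bumpSeq (Function.update k j a) = Function.update (bumpSeq k) j (some a) := by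
  funext i
  by_cases hi : i = j
  · subst hi; simp [bumpSeq]
  · by_cases h : i < J
    · have : (⟨i, h⟩ : Fin J) ≠ j := fun h' => hi (by rw [← h'])
      simp [bumpSeq, h, hi, this]
    · simp [bumpSeq, h, hi]

lemma sum_misses_le_expectedRegret {J K n T : ℕ} (hn : 1 ≤ n) (hT : n * J ≤ T)
    (k : Fin J → Fin K) (π : Algorithm) :
    ∑ j : Fin J, 1 / (2 * (K : ℝ)) * ∫ h, ((n : ℝ) - hits (block T n j) (cell (k j)) h)
        ∂(historyLaw (biasedEnv (blockBias n (bumpSeq k))) π T) ≤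
      expectedRegret (biasedEnv (blockBias n (bumpSeq k))) π T := by
  set e := biasedEnv (blockBias n (bumpSeq k)) with he
  have hI (j : Fin J) : Integrable (fun h => (n : ℝ) - hits (block T n j) (cell (k j)) h)
      (historyLaw e π T) :=
    (integrable_const _).sub (integrable_hits _ (measurableSet_cell _) _)
  have hgapm (i : Fin T) : Measurable fun h : History T => e.gap ((i : ℕ) + 1) (h i).1 := by
    have := measurable_gap (blockBias n (bumpSeq k)) (i + 1)
    exact this.comp (measurable_fst.comp (measurable_pi_apply i))
  have hgapI (i : Fin T) : Integrable (fun h : History T => e.gap ((i : ℕ) + 1) (h i).1)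
      (historyLaw e π T) :=
    Integrable.of_bound (hgapm i).aestronglyMeasurable 1 (ae_of_all _ fun h => by
      rw [Real.norm_of_nonneg (gap_nonneg _ _ _)]; exact gap_le_one _ _ _)
  simp_rw [← integral_const_mul]
  rw [← integral_finsetSum _ fun j _ => (hI j).const_mul _, expectedRegret]
  refine integral_mono (integrable_finsetSum _ fun j _ => (hI j).const_mul _)
    (integrable_finsetSum _ fun i _ => hgapI i) fun h => ?_
  have hblock (j : Fin J) : 1 / (2 * (K : ℝ)) * (n - hits (block T n j) (cell (k j)) h) ≤
      ∑ i ∈ block T n j, e.gap ((i : ℕ) + 1) (h i).1 := by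
    have hcard : ((block T n j).card : ℝ) = n := by
      rw [card_block hn ((Nat.mul_le_mul_left n j.2).trans hT)]
    have : (n : ℝ) - hits (block T n j) (cell (k j)) h =
        ∑ i ∈ block T n j, (1 - (cell (k j)).indicator 1 (h i).1) := by
      rw [Finset.sum_sub_distrib, hits, ← hcard]; simp
    rw [this, Finset.mul_sum]
    refine Finset.sum_le_sum fun i hi => le_gap_blockBias ?_ _
    have hi' : (i : ℕ) / n = j := (Finset.mem_filter.mp hi).2
    simp [bumpSeq, hi']
  refine (Finset.sum_le_sum fun j _ => hblock j).trans ?_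
  rw [← Finset.sum_biUnion]
  · exact Finset.sum_le_sum_of_subset_of_nonneg (Finset.subset_univ _) fun i _ _ =>
      gap_nonneg _ _ _
  · intro j _ j' _ hjj
    refine Finset.disjoint_left.mpr fun i hi hi' => hjj (Fin.ext ?_)
    rw [← (Finset.mem_filter.mp hi).2, ← (Finset.mem_filter.mp hi').2]

/-! ### The hard instances -/

/-- For `J` blocks of `n = r ^ 3` rounds within the horizon there is an environment with at most `J`
changes, of size at most `1 / r` each, on which the algorithm has regret at least of order `r ^ 2`
in each block. There is no change if a single block fills the horizon. -/
lemma exists_hard_environment (π : Algorithm) {T n J : ℕ} (hn : 1 ≤ n) (hT : n * J ≤ T) {r : ℝ}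
    (hr : 0 < r) (hrn : r ^ 3 = n) :
    ∃ e : Environment, numSignificantShifts e T ≤ J ∧ totalVariation e T ≤ J * (1 / r) ∧
      (T = n → J = 1 → totalVariation e T ≤ 0) ∧ J * (r ^ 2 / 32) ≤ expectedRegret e π T := by
  have hr1 : 1 ≤ r := by
    by_contra h
    have : r ^ 3 < 1 := pow_lt_one₀ hr.le (by linarith) (by norm_num)
    have : (1 : ℝ) ≤ n := by exact_mod_cast hn
    linarith
  -- `K ^ 3 ≥ 27 n` makes the relative loss `1 / K + 4 n / K ^ 3` in `le_sum_integral_misses` smaller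
  -- than `5 / 8`
  set K := ⌈3 * r⌉₊ with hKdef
  have hK3 : 3 * r ≤ K := Nat.le_ceil _
  have hK4 : (K : ℝ) ≤ 4 * r := by
    have := Nat.ceil_lt_add_one (a := 3 * r) (by positivity)
    linarith
  have hK : 2 ≤ K := by
    have : (2 : ℝ) ≤ K := by linarith
    exact_mod_cast this
  have : Nonempty (Fin K) := ⟨⟨0, by omega⟩⟩
  have hKpos : (0 : ℝ) < K := by linarith
  have hnum : (K : ℝ) * (r ^ 2 / 32) ≤
      1 / (2 * (K : ℝ)) * ((n : ℝ) * K * (7 / 8) - (1 + 4 * n / (K : ℝ) ^ 2) * n) := by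
    rw [← hrn]
    have h1 : 4 * r ^ 3 / (K : ℝ) ^ 2 ≤ K * (4 / 27) := by
      rw [div_le_iff₀ (by positivity)]
      have := pow_le_pow_left₀ (by positivity) hK3 3
      nlinarith
    have h2 : r ^ 3 * (K / 4) ≤ r ^ 3 * K * (7 / 8) - (1 + 4 * r ^ 3 / (K : ℝ) ^ 2) * r ^ 3 := by
      have : K / 4 ≤ (K : ℝ) * (7 / 8) - (1 + 4 * r ^ 3 / (K : ℝ) ^ 2) := by linarith
      have := mul_le_mul_of_nonneg_left this (by positivity : 0 ≤ r ^ 3)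
      linarith
    calc (K : ℝ) * (r ^ 2 / 32) ≤ 4 * r * (r ^ 2 / 32) := by gcongr
      _ = 1 / (2 * (K : ℝ)) * (r ^ 3 * (K / 4)) := by field_simp; norm_num
      _ ≤ _ := by gcongr
  obtain ⟨k, hk⟩ := exists_card_mul_le_sum (ι := Fin J) (κ := Fin K)
    (fun j k => 1 / (2 * (K : ℝ)) * ∫ h, ((n : ℝ) - hits (block T n j) (cell (k j)) h)
        ∂(historyLaw (biasedEnv (blockBias n (bumpSeq k))) π T)) (r ^ 2 / 32) fun j k => by
    simp only [bumpSeq_update, Function.update_self, Fintype.card_fin]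
    rw [← Finset.mul_sum]
    refine hnum.trans ?_
    gcongr
    exact le_sum_integral_misses hK π hn ((Nat.mul_le_mul_left n j.2).trans hT) _
  rw [Fintype.card_fin] at hk
  set e := biasedEnv (blockBias n (bumpSeq k)) with he
  -- the rounds after which a new block starts
  set D := ((Finset.range J).image fun j => n * (j + 1)).filter (· < T) with hDdef
  have hDcard : D.card ≤ J :=
    (Finset.card_filter_le _ _).trans (Finset.card_image_le.trans (Finset.card_range J).le)
  have hD : ∀ t, 1 ≤ t → t < T → t ∉ D → e.mean (t + 1) = e.mean t := by
    intro t ht1 htT htD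
    have : bumpSeq k ((t + 1 - 1) / n) = bumpSeq k ((t - 1) / n) := by
      by_cases hdvd : n ∣ t
      · obtain ⟨m, rfl⟩ := hdvd
        have hm : m ≠ 0 := by rintro rfl; simp at ht1
        obtain ⟨j, rfl⟩ := Nat.exists_eq_succ_of_ne_zero hm
        have hj : J ≤ j := by
          by_contra hlt
          exact htD (Finset.mem_filter.mpr ⟨Finset.mem_image.mpr
            ⟨j, Finset.mem_range.mpr (by omega), rfl⟩, htT⟩)
        have h1 : J ≤ (n * (j + 1) + 1 - 1) / n := by
          rw [Nat.le_div_iff_mul_le (by omega)]; simp only [Nat.add_sub_cancel]; nlinarith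
        have h2 : J ≤ (n * (j + 1) - 1) / n := by
          rw [Nat.le_div_iff_mul_le (by omega)]
          have : J * n ≤ j * n := Nat.mul_le_mul_right n hj
          have : n * (j + 1) = j * n + n := by ring
          omega
        simp only [bumpSeq, Nat.succ_eq_add_one, h1.not_gt, h2.not_gt, dite_false]
      · have := Nat.succ_div_of_not_dvd (a := t - 1) (b := n) (by rwa [Nat.sub_add_cancel ht1])
        rw [Nat.sub_add_cancel ht1] at this
        rw [Nat.add_sub_cancel, this]
    funext x
    rw [biasedEnv_mean, biasedEnv_mean, blockBias, blockBias, this]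
  have hstep : ∀ t x, |e.mean (t + 1) x - e.mean t x| ≤ 1 / r := by
    intro t x
    have hKr : 1 / (2 * (K : ℝ)) ≤ 1 / r := one_div_le_one_div_of_le hr (by linarith)
    have h1 := bump_val_nonneg (bumpSeq k ((t + 1 - 1) / n)) x
    have h2 := bump_val_le (bumpSeq k ((t + 1 - 1) / n)) x
    have h3 := bump_val_nonneg (bumpSeq k ((t - 1) / n)) x
    have h4 := bump_val_le (bumpSeq k ((t - 1) / n)) x
    rw [biasedEnv_mean, biasedEnv_mean, blockBias, blockBias, abs_le]
    constructor <;> linarith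
  have htv := totalVariation_le_card_mul e T D (by positivity) hD hstep
  refine ⟨e, ?_, ?_, ?_, hk.trans (sum_misses_le_expectedRegret hn hT k π)⟩
  · refine (numSignificantShifts_le_card e T D hD (exists_gap_eq_zero _)).trans ?_
    exact_mod_cast hDcard
  · refine htv.trans ?_
    gcongr
  · rintro rfl rfl
    have : D = ∅ := by
      simp [hDdef, Finset.filter_eq_empty_iff]
    simpa [this] using htv

/-! ### The two lower bounds -/

lemma le_two_mul_mul_div {m n : ℕ} (hn : 1 ≤ n) (hm : n ≤ m) : m ≤ 2 * (n * (m / n)) := by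
  have h1 := Nat.div_add_mod m n
  have h2 := Nat.mod_lt m hn
  have h3 : 1 ≤ m / n := (Nat.one_le_div_iff hn).mpr hm
  have : n * 1 ≤ n * (m / n) := Nat.mul_le_mul_left n h3
  omega

lemma shift_lower_bound (T : ℕ) (L : ℕ) (hL : L ≤ T) (π : Algorithm) :
    ∃ e ∈ shiftClass T L,
      1 / 128 * ((L : ℝ) ^ (1 / 3 : ℝ) * (T : ℝ) ^ (2 / 3 : ℝ)) ≤ expectedRegret e π T := by
  rcases Nat.eq_zero_or_pos L with rfl | hLpos
  · obtain ⟨e, h1, -, -, h2⟩ := exists_hard_environment π (T := T) (n := 1) (J := 0) le_rfl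
      (by simp) one_pos (by norm_num)
    refine ⟨e, h1, ?_⟩
    simpa [Real.zero_rpow] using h2
  · have hn : 1 ≤ T / L := (Nat.one_le_div_iff hLpos).mpr hL
    have hT2 : (T : ℝ) ≤ 2 * (L * (T / L : ℕ)) := by
      exact_mod_cast le_two_mul_mul_div hLpos hL
    set n := T / L
    set r : ℝ := (n : ℝ) ^ (1 / 3 : ℝ) with hr
    set u : ℝ := (L : ℝ) ^ (1 / 3 : ℝ) with hu
    set s : ℝ := (T : ℝ) ^ (1 / 3 : ℝ) with hs
    have hnpos : (0 : ℝ) < n := by exact_mod_cast hn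
    have hr0 : 0 < r := Real.rpow_pos_of_pos hnpos _
    have hu0 : 0 ≤ u := by positivity
    have hs0 : 0 ≤ s := by positivity
    have hr3 : r ^ 3 = n := by rw [hr, ← Real.rpow_mul_natCast (by positivity)]; norm_num
    have hu3 : u ^ 3 = L := by rw [hu, ← Real.rpow_mul_natCast (by positivity)]; norm_num
    have hs3 : s ^ 3 = T := by rw [hs, ← Real.rpow_mul_natCast (by positivity)]; norm_num
    have hs2 : (T : ℝ) ^ (2 / 3 : ℝ) = s ^ 2 := by
      rw [hs, ← Real.rpow_mul_natCast (by positivity)]; norm_num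
    obtain ⟨e, h1, -, -, h2⟩ := exists_hard_environment π (T := T) (n := n) (J := L) hn
      (Nat.div_mul_le_self T L) hr0 hr3
    refine ⟨e, h1, le_trans ?_ h2⟩
    have hsle : s ≤ 2 * (u * r) := by
      refine le_of_pow_le_pow_left₀ (n := 3) (by norm_num) (by positivity) ?_
      have : (2 * (u * r)) ^ 3 = 8 * (L * n) := by rw [← hu3, ← hr3]; ring
      rw [this, hs3]
      have : (0 : ℝ) ≤ L * n := by positivity
      linarith
    rw [hs2, ← hu3]
    calc 1 / 128 * (u * s ^ 2) ≤ 1 / 128 * (u * (2 * (u * r)) ^ 2) := by gcongr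
      _ = u ^ 3 * (r ^ 2 / 32) := by ring

lemma variation_lower_bound (T : ℕ) (hT : 1 ≤ T) (V : ℝ) (hV0 : 0 ≤ V) (hVT : V ≤ T)
    (π : Algorithm) :
    ∃ e ∈ variationClass T V,
      1 / 256 * ((T : ℝ) ^ (2 / 3 : ℝ) + V ^ (1 / 4 : ℝ) * (T : ℝ) ^ (3 / 4 : ℝ)) ≤
        expectedRegret e π T := by
  have hT1 : (1 : ℝ) ≤ T := by exact_mod_cast hT
  -- with `T = s ^ 12` and `V = v ^ 4` all the exponents become integers
  set s : ℝ := (T : ℝ) ^ (1 / 12 : ℝ) with hs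
  set v : ℝ := V ^ (1 / 4 : ℝ) with hv
  have hs0 : 0 < s := Real.rpow_pos_of_pos (by linarith) _
  have hv0 : 0 ≤ v := by positivity
  have hs12 : s ^ 12 = T := by rw [hs, ← Real.rpow_mul_natCast (by positivity)]; norm_num
  have hs8 : (T : ℝ) ^ (2 / 3 : ℝ) = s ^ 8 := by
    rw [hs, ← Real.rpow_mul_natCast (by positivity)]; norm_num
  have hs9 : (T : ℝ) ^ (3 / 4 : ℝ) = s ^ 9 := by
    rw [hs, ← Real.rpow_mul_natCast (by positivity)]; norm_num
  have hv4 : v ^ 4 = V := by rw [hv, ← Real.rpow_mul_natCast hV0]; norm_num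
  rw [hs8, hs9]
  rcases le_or_gt (v * s) 1 with hvs | hvs
  · obtain ⟨e, -, -, h1, h2⟩ := exists_hard_environment π (T := T) (n := T) (J := 1) hT
      (by simp) (r := s ^ 4) (by positivity) (by rw [← hs12]; ring)
    refine ⟨e, (h1 rfl rfl).trans hV0, le_trans ?_ h2⟩
    have h3 : v * s ^ 9 ≤ s ^ 8 := by
      calc v * s ^ 9 = s ^ 8 * (v * s) := by ring
        _ ≤ s ^ 8 * 1 := by gcongr
        _ = s ^ 8 := mul_one _
    have h4 : 0 ≤ s ^ 8 := by positivity
    have h5 : (s ^ 4) ^ 2 = s ^ 8 := by ring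
    rw [h5, Nat.cast_one]
    linarith
  · have hvpos : 0 < v := by
      rcases hv0.eq_or_lt with h | h
      · rw [← h] at hvs; linarith
      · exact h
    have hvs3 : v ≤ s ^ 3 := by
      refine le_of_pow_le_pow_left₀ (n := 4) (by norm_num) (by positivity) ?_
      rw [hv4, ← pow_mul]
      simpa [hs12] using hVT
    -- blocks of about `(T / V) ^ (3 / 4)` rounds
    set p : ℝ := s ^ 3 / v with hp
    have hp1 : 1 ≤ p := (one_le_div hvpos).mpr hvs3
    have hpv : p * v = s ^ 3 := div_mul_cancel₀ _ hvpos.ne'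
    set n := ⌈p ^ 3⌉₊ with hndef
    have hpn : p ^ 3 ≤ n := Nat.le_ceil _
    have hp3 : 1 ≤ p ^ 3 := one_le_pow₀ hp1
    have hn2 : (n : ℝ) ≤ 2 * p ^ 3 := by
      have := Nat.ceil_lt_add_one (a := p ^ 3) (by positivity)
      linarith
    have hn : 1 ≤ n := by
      have : (1 : ℝ) ≤ n := by linarith
      exact_mod_cast this
    have hnT : n ≤ T := by
      rw [hndef, Nat.ceil_le, ← hs12]
      have : p ≤ s ^ 4 := by
        rw [hp, div_le_iff₀ hvpos]
        calc s ^ 3 = s ^ 3 * 1 := (mul_one _).symm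
          _ ≤ s ^ 3 * (v * s) := by gcongr
          _ = s ^ 4 * v := by ring
      calc p ^ 3 ≤ (s ^ 4) ^ 3 := by gcongr
        _ = s ^ 12 := by ring
    have hnpos : (0 : ℝ) < n := by exact_mod_cast hn
    set J := T / n
    have hJ1 : n * J ≤ T := Nat.mul_div_le T n
    have hJT : (n : ℝ) * J ≤ T := by exact_mod_cast hJ1
    have hJ2 : (T : ℝ) ≤ 2 * (n * J) := by exact_mod_cast le_two_mul_mul_div hn hnT
    set r : ℝ := (n : ℝ) ^ (1 / 3 : ℝ) with hr
    have hr0 : 0 < r := Real.rpow_pos_of_pos hnpos _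
    have hr3 : r ^ 3 = n := by rw [hr, ← Real.rpow_mul_natCast (by positivity)]; norm_num
    have hpr : p ≤ r := le_of_pow_le_pow_left₀ (n := 3) (by norm_num) hr0.le (by rwa [hr3])
    have hrp : r ≤ 2 * p := by
      refine le_of_pow_le_pow_left₀ (n := 3) (by norm_num) (by positivity) ?_
      rw [hr3, mul_pow]
      linarith
    obtain ⟨e, -, h1, -, h2⟩ := exists_hard_environment π hn hJ1 hr0 hr3
    refine ⟨e, h1.trans ?_, le_trans ?_ h2⟩
    · -- `n r = r ^ 4 ≥ p ^ 4 = T / V`, so that `J / r ≤ T / (n r) ≤ V`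
      rw [mul_one_div, div_le_iff₀ hr0, ← hv4]
      refine le_of_mul_le_mul_left ?_ hnpos
      calc (n : ℝ) * J ≤ s ^ 12 := by rw [hs12]; exact hJT
        _ = (p * v) ^ 4 := by rw [hpv]; ring
        _ = p ^ 4 * v ^ 4 := by ring
        _ ≤ r ^ 4 * v ^ 4 := by gcongr
        _ = n * (v ^ 4 * r) := by rw [← hr3]; ring
    · have h3 : s ^ 8 ≤ v * s ^ 9 := by
        calc s ^ 8 = s ^ 8 * 1 := (mul_one _).symm
          _ ≤ s ^ 8 * (v * s) := by gcongr
          _ = v * s ^ 9 := by ring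
      have h4 : v * s ^ 9 ≤ 4 * (J * r ^ 2) := by
        refine le_of_mul_le_mul_right ?_ (by positivity : 0 < p)
        calc v * s ^ 9 * p = s ^ 9 * (p * v) := by ring
          _ = s ^ 12 := by rw [hpv]; ring
          _ ≤ 2 * (n * J) := by rw [hs12]; exact hJ2
          _ = 2 * (J * r ^ 2) * r := by rw [← hr3]; ring
          _ ≤ 2 * (J * r ^ 2) * (2 * p) := by gcongr
          _ = 4 * (J * r ^ 2) * p := by ring
      linarith

end LipBandit

theorem theorem1 :
    (∃ c₁ : ℝ, 0 < c₁ ∧ ∀ T : ℕ, 1 ≤ T → ∀ L : ℕ, L ≤ T → ∀ π : LipBandit.Algorithm,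
      ∃ e ∈ LipBandit.shiftClass T L,
        c₁ * ((L : ℝ) ^ (1 / 3 : ℝ) * (T : ℝ) ^ (2 / 3 : ℝ)) ≤ LipBandit.expectedRegret e π T) ∧
    (∃ c₂ : ℝ, 0 < c₂ ∧ ∀ T : ℕ, 1 ≤ T → ∀ V : ℝ, 0 ≤ V → V ≤ T → ∀ π : LipBandit.Algorithm,
      ∃ e ∈ LipBandit.variationClass T V,
        c₂ * ((T : ℝ) ^ (2 / 3 : ℝ) + V ^ (1 / 4 : ℝ) * (T : ℝ) ^ (3 / 4 : ℝ)) ≤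
          LipBandit.expectedRegret e π T) :=
  ⟨⟨1 / 128, by norm_num, fun T _ L hL π => LipBandit.shift_lower_bound T L hL π⟩,
    ⟨1 / 256, by norm_num, fun T hT V hV0 hVT π =>
      LipBandit.variation_lower_bound T hT V hV0 hVT π⟩⟩
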